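/- Let $d\ge 0$ and $M\ge 2d$ be integers. Call a complex matrix $A$ orthonormal if $A^HA=I$. For orthonormal $V,\hat V\in\mathbb C^{M\times d}$ let $$d_c^2(V,\hat V)=\tfrac12\,\|VV^H-\hat V\hat V^H\|_F^2 ,$$ and let $\hat V^{\rm null}\in\mathbb C^{M\times(M-d)}$ be an orthonormal matrix with $\hat V^H\hat V^{\rm null}=0$. (1) For all orthonormal $V,\hat V\in\mathbb C^{M\times d}$ and every such $\hat V^{\rm null}$ there are orthonormal matrices $X\in\mathbb C^{d\times d}$ and $S\in\mathbb C^{(M-d)\times d}$ and upper triangular matrices $Y,Z\in\mathbb C^{d\times d}$ with real non-negative diagonal entries such that $$V=\hat V XY+\hat V^{\rm null}SZ ,$$ where in addition the diagonal of $Y$ is positive if $\det(\hat V^HV)\neq0$, and the diagonal of $Z$ is positive if $\det\big(I_d-(\hat V^HV)^H(\hat V^HV)\big)\neq0$. All such factors satisfy $$\operatorname{tr}(Z^HZ)=d_c^2(V,\hat V),\qquad Y^HY=I_d-Z^HZ .$$ (2) Let $V,\hat V$ be random orthonormal $M\times d$ matrices on a probability space, and let $\hat V^{\rm null}=\operatorname{null}(\hat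 V)$, where $\operatorname{null}$ is a measurable map that assigns to each orthonormal $M\times d$ matrix an orthonormal basis of its left null space. Assume that one of the following holds: (a) the law of $V$ is invariant under multiplication from the left by every $M\times M$ unitary matrix, and $V$ is independent of $\hat V$ (for example, $\hat V$ is deterministic); or (b) for all unitary $Q\in\mathbb C^{M\times M}$ and $U\in\mathbb C^{d\times d}$ the pair $(QV,\,Q\hat VU)$ has the same law as $(V,\hat V)$, and almost surely $\det(\hat V^HV)\ne0$ and $\det\big(I_d-(\hat V^HV)^H(\hat V^HV)\big)\neq0$. Then there are random matrices $X,Y,S,Z$ that almost surely form a decomposition as in (1) in which both $Y$ and $Z$ have positive diagonals; and for all random matrices $X,Y,S,Z$ with this property, $X$ and $Y$ are independent, and $S$ and $Z$ are independent. -/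

import Mathlib

open Matrix MeasureTheory ProbabilityTheory

/-- The entrywise product (equivalently, Borel) σ-algebra on complex matrices. -/
noncomputable instance matrixMeasurableSpace {m n : ℕ} : MeasurableSpace (Matrix (Fin m) (Fin n) ℂ) :=
  (MeasurableSpace.pi : MeasurableSpace (Fin m → Fin n → ℂ))

/-- The columns of `A` are orthonormal: `Aᴴ A = I`. -/
def OrthonormalCols {m n : ℕ} (A : Matrix (Fin m) (Fin n) ℂ) : Prop :=
  Aᴴ * A = 1

/-- The squared Frobenius norm. -/
noncomputable def frobSq {m n : ℕ} (A : Matrix (Fin m) (Fin n) ℂ) : ℝ :=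
  ∑ i, ∑ j, ‖A i j‖ ^ 2

/-- The squared chordal distance `(1/2) ‖V Vᴴ - V̂ V̂ᴴ‖_F²`. -/
noncomputable def chordalDistSq {M d : ℕ} (V Vh : Matrix (Fin M) (Fin d) ℂ) : ℝ :=
  (1 / 2) * frobSq (V * Vᴴ - Vh * Vhᴴ)

/-- `N` is an orthonormal basis, written as an `M × (M - d)` matrix, of the left null space
`{x | V̂ᴴ x = 0}` of `V̂`. -/
def IsLeftNullBasis {M d : ℕ} (Vh : Matrix (Fin M) (Fin d) ℂ)
    (N : Matrix (Fin M) (Fin (M - d)) ℂ) : Prop :=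
  OrthonormalCols N ∧ Vhᴴ * N = 0

/-- Upper triangular with real nonnegative diagonal entries. -/
def IsUpperTriNonneg {d : ℕ} (Y : Matrix (Fin d) (Fin d) ℂ) : Prop :=
  (∀ i j, j < i → Y i j = 0) ∧ ∀ i, 0 ≤ (Y i i).re ∧ (Y i i).im = 0

/-- Upper triangular with real positive diagonal entries. -/
def IsUpperTriPos {d : ℕ} (Y : Matrix (Fin d) (Fin d) ℂ) : Prop :=
  (∀ i j, j < i → Y i j = 0) ∧ ∀ i, 0 < (Y i i).re ∧ (Y i i).im = 0

/-- `V = V̂ X Y + V̂^null S Z` with `X`, `S` orthonormal and `Y`, `Z` upper triangular with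
nonnegative diagonal. -/
structure IsCDDecomp {M d : ℕ} (V Vh : Matrix (Fin M) (Fin d) ℂ)
    (N : Matrix (Fin M) (Fin (M - d)) ℂ) (X Y : Matrix (Fin d) (Fin d) ℂ)
    (S : Matrix (Fin (M - d)) (Fin d) ℂ) (Z : Matrix (Fin d) (Fin d) ℂ) : Prop where
  eq : V = Vh * X * Y + N * S * Z
  orthX : OrthonormalCols X
  orthS : OrthonormalCols S
  triY : IsUpperTriNonneg Y
  triZ : IsUpperTriNonneg Z

/-- `V` has an isotropic law: the law is invariant under multiplication from the left by every
`M × M` unitary matrix. For an orthonormal `V` this is the uniform law on the Stiefel manifold. -/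
def IsIsotropic {Ω : Type*} [MeasurableSpace Ω] (μ : Measure Ω) {M d : ℕ}
    (V : Ω → Matrix (Fin M) (Fin d) ℂ) : Prop :=
  ∀ Q ∈ unitaryGroup (Fin M) ℂ, μ.map (fun ω => Q * V ω) = μ.map V

/-- The pair `(V, V̂)` is jointly isotropic: its joint law does not change when both matrices are
rotated by the same `M × M` unitary matrix, nor when the orthonormal basis `V̂` of its column space
is replaced by another one. This holds, for example, when `V` is isotropic and `V̂` is the element
closest to `V` in chordal distance of a random codebook of independent isotropic matrices that is
independent of `V`. -/
def IsJointlyIsotropic {Ω : Type*} [MeasurableSpace Ω] (μ : Measure Ω) {M d : ℕ}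
    (V Vh : Ω → Matrix (Fin M) (Fin d) ℂ) : Prop :=
  ∀ Q ∈ unitaryGroup (Fin M) ℂ, ∀ U ∈ unitaryGroup (Fin d) ℂ,
    μ.map (fun ω => (Q * V ω, Q * Vh ω * U)) = μ.map (fun ω => (V ω, Vh ω))

/-- No principal angle between the column spaces of `V` and `V̂` is `0` or `π / 2`. -/
def InGeneralPosition {M d : ℕ} (V Vh : Matrix (Fin M) (Fin d) ℂ) : Prop :=
  (Vhᴴ * V).det ≠ 0 ∧ (1 - (Vhᴴ * V)ᴴ * (Vhᴴ * V)).det ≠ 0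

/-! Since `V̂ V̂ᴴ + N Nᴴ = 1` for a null basis `N`, a decomposition is the same thing as a pair of
QR decompositions `V̂ᴴ V = X Y` and `Nᴴ V = S Z`. The identity `(Nᴴ V)ᴴ (Nᴴ V) = 1 - (V̂ᴴ V)ᴴ (V̂ᴴ
V)` then gives the Gram relation, the trace formula and the positivity of the diagonals
(`IsLeftNullBasis.gram_add_gram`).

For independence, a QR decomposition with positive diagonal is unique, so the random factors agree
almost surely with measurable Gram-Schmidt functions of `(V, V̂)`. Multiplying a matrix of full
column rank by a unitary changes only its orthonormal factor (`qr_mul_left`). If the law of the pair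
is invariant under such changes and these act transitively on the orthonormal factor, averaging over
an invariant measure on the unitary group separates the two factors (`indepFun_of_invariant`). The
three applications differ in what is rotated: `V` alone, by a unitary depending on `V̂`; the basis
`V̂` of its column space; or `V` and `V̂` together.

In the isotropic case full rank has to be proved. No density is used: the degeneracy event has the
same probability for infinitely many rotated frames, yet a given `V` is degenerate for only finitely
many of them (`ae_det_ne_zero_of_invariant`). -/

/-! ### QR decomposition: existence, uniqueness, equivariance -/

/-- The columns of `A`, followed by zero vectors. -/
noncomputable def paddedCols {m d : ℕ} (A : Matrix (Fin m) (Fin d) ℂ) :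
    Fin m → EuclideanSpace ℂ (Fin m) :=
  fun j => if h : (j : ℕ) < d then WithLp.toLp 2 (fun i => A i ⟨j, h⟩) else 0

open InnerProductSpace in
/-- The orthonormal factor of the QR decomposition, obtained by Gram-Schmidt orthonormalization
of the columns (with junk value if these are linearly dependent). -/
noncomputable def qFactor {m d : ℕ} (h : d ≤ m) (A : Matrix (Fin m) (Fin d) ℂ) :
    Matrix (Fin m) (Fin d) ℂ :=
  Matrix.of fun i j => gramSchmidtNormed ℂ (paddedCols A) (Fin.castLE h j) i

/-- The triangular factor of the QR decomposition. -/
noncomputable def rFactor {m d : ℕ} (h : d ≤ m) (A : Matrix (Fin m) (Fin d) ℂ) :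
    Matrix (Fin d) (Fin d) ℂ :=
  (qFactor h A)ᴴ * A

theorem inner_toLp_eq {m d : ℕ} (S : Matrix (Fin m) (Fin d) ℂ) (A : Matrix (Fin m) (Fin d) ℂ)
    (i j : Fin d) :
    inner ℂ (WithLp.toLp 2 (fun k => S k i) : EuclideanSpace ℂ (Fin m))
      (WithLp.toLp 2 (fun k => A k j)) = (Sᴴ * A) i j := by
  simp [PiLp.inner_apply, Matrix.mul_apply, mul_comm]

theorem IsUpperTriNonneg.isUpperTriPos {d : ℕ} {Y : Matrix (Fin d) (Fin d) ℂ}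
    (h : IsUpperTriNonneg Y) (hY : Y.det ≠ 0) : IsUpperTriPos Y := by
  refine ⟨h.1, fun i => ⟨lt_of_le_of_ne (h.2 i).1 fun h0 => hY ?_, (h.2 i).2⟩⟩
  rw [Matrix.det_of_isUpperTriangular (fun a b hab => h.1 a b hab)]
  exact Finset.prod_eq_zero (Finset.mem_univ i) (Complex.ext h0.symm (h.2 i).2)

theorem IsUpperTriPos.det_ne_zero {d : ℕ} {Y : Matrix (Fin d) (Fin d) ℂ}
    (h : IsUpperTriPos Y) : Y.det ≠ 0 := by
  rw [Matrix.det_of_isUpperTriangular (fun a b hab => h.1 a b hab)]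
  refine Finset.prod_ne_zero_iff.2 fun i _ h0 => ?_
  have := (h.2 i).1
  rw [h0] at this
  simp at this

open InnerProductSpace in
/-- QR decomposition of a tall matrix, for which the factors are given by Gram-Schmidt if the matrix
has full column rank. -/
theorem exists_qr_eq_qFactor {m d : ℕ} (h : d ≤ m) (A : Matrix (Fin m) (Fin d) ℂ) :
    ∃ (S : Matrix (Fin m) (Fin d) ℂ) (R : Matrix (Fin d) (Fin d) ℂ), OrthonormalCols S ∧ IsUpperTriNonneg R ∧
      A = S * R ∧ ((Aᴴ * A).det ≠ 0 → S = qFactor h A) := by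
  have hc : Module.finrank ℂ (EuclideanSpace ℂ (Fin m)) = Fintype.card (Fin m) := by simp
  set f := paddedCols A with hf
  have hfA : ∀ j : Fin d, f (Fin.castLE h j) = WithLp.toLp 2 (fun i => A i j) := fun j => by
    simp [hf, paddedCols]
  -- This basis takes other orthonormal vectors wherever Gram-Schmidt produces zero, which covers
  -- the rank-deficient case. It requires as many input vectors as the dimension, hence the zero
  -- padding.
  set b := gramSchmidtOrthonormalBasis hc f with hb
  let S : Matrix (Fin m) (Fin d) ℂ := Matrix.of fun i j => b (Fin.castLE h j) i
  have hbS : ∀ j : Fin d, b (Fin.castLE h j) = WithLp.toLp 2 (fun i => S i j) := fun j => rfl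
  have hSA : ∀ i j, (Sᴴ * A) i j = inner ℂ (b (Fin.castLE h i)) (f (Fin.castLE h j)) :=
    fun i j => by rw [hfA, hbS, inner_toLp_eq]
  have hinj : Function.Injective (Fin.castLE h) := Fin.castLE_injective h
  have horth : OrthonormalCols S := by
    ext i j
    rw [← inner_toLp_eq, ← hbS, ← hbS, orthonormal_iff_ite.1 b.orthonormal, Matrix.one_apply]
    simp [hinj.eq_iff]
  have htri : IsUpperTriNonneg (Sᴴ * A) := by
    refine ⟨fun i j hij => ?_, fun i => ?_⟩
    · rw [hSA]
      exact gramSchmidtOrthonormalBasis_inv_triangular hc f (Fin.castLE_lt_castLE_iff h |>.2 hij)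
    · rw [hSA]
      by_cases h0 : gramSchmidtNormed ℂ f (Fin.castLE h i) = 0
      · rw [inner_gramSchmidtOrthonormalBasis_eq_zero hc h0]; simp
      · have hi : inner ℂ (b (Fin.castLE h i)) (f (Fin.castLE h i)) =
            ((‖gramSchmidt ℂ f (Fin.castLE h i)‖ : ℝ) : ℂ) := by
          have hg : gramSchmidt ℂ f (Fin.castLE h i) ≠ 0 := fun h1 => h0 (by
            simp [gramSchmidtNormed, h1])
          have h2 := gramSchmidt_def' ℂ f (Fin.castLE h i)
          rw [gramSchmidtOrthonormalBasis_apply hc h0]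
          conv_lhs => rw [h2]
          rw [inner_add_right, inner_sum, Finset.sum_eq_zero, add_zero, gramSchmidtNormed,
            inner_smul_left, inner_self_eq_norm_sq_to_K]
          · have : (‖gramSchmidt ℂ f (Fin.castLE h i)‖ : ℂ) ≠ 0 := by
              simpa using hg
            simp
            field_simp
          · intro k hk
            rw [Submodule.starProjection_singleton, inner_smul_right, gramSchmidtNormed,
              inner_smul_left, gramSchmidt_orthogonal ℂ f (Finset.mem_Iio.1 hk).ne']
            simp
        rw [hi]
        simp
  have hA : A = S * (Sᴴ * A) := by
    ext i j
    have h1 := b.sum_repr' (f (Fin.castLE h j))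
    have h2 := congrArg (fun v : EuclideanSpace ℂ (Fin m) => v i) h1
    rw [hfA] at h2
    simp only [WithLp.ofLp_sum, WithLp.ofLp_smul, Finset.sum_apply, Pi.smul_apply,
      smul_eq_mul] at h2
    rw [← h2, Matrix.mul_apply]
    symm
    refine Fintype.sum_of_injective (Fin.castLE h) hinj _ _ (fun k hk => ?_) fun k => ?_
    -- Basis vectors with index at least `d` come after every column of `A`, so triangularity
    -- removes their coefficients.
    · have hk' : Fin.castLE h j < k := by
        by_contra hlt
        refine hk ⟨⟨k, ?_⟩, Fin.ext rfl⟩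
        have : (k : ℕ) ≤ j := not_lt.1 hlt
        omega
      rw [← hfA, hb, gramSchmidtOrthonormalBasis_inv_triangular hc f hk', zero_mul]
    · rw [hSA, hfA, mul_comm]
      rfl
  refine ⟨S, Sᴴ * A, horth, htri, hA, fun hdet => ?_⟩
  have hR : (Sᴴ * A).det ≠ 0 := by
    intro h0
    apply hdet
    rw [hA, conjTranspose_mul, Matrix.mul_assoc, ← Matrix.mul_assoc Sᴴ S, horth, Matrix.one_mul,
      det_mul, h0, mul_zero]
  have hpos := htri.isUpperTriPos hR
  ext i j
  have h0 : gramSchmidtNormed ℂ f (Fin.castLE h j) ≠ 0 := fun h0 => by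
    have := (hpos.2 j).1
    rw [hSA, inner_gramSchmidtOrthonormalBasis_eq_zero hc h0] at this
    simp at this
  change b (Fin.castLE h j) i = gramSchmidtNormed ℂ f (Fin.castLE h j) i
  rw [hb, gramSchmidtOrthonormalBasis_apply hc h0]

theorem gram_eq {m d k : ℕ} {S : Matrix (Fin m) (Fin d) ℂ} (hS : OrthonormalCols S)
    (R : Matrix (Fin d) (Fin k) ℂ) : (S * R)ᴴ * (S * R) = Rᴴ * R := by
  rw [conjTranspose_mul, Matrix.mul_assoc, ← Matrix.mul_assoc Sᴴ S, hS, Matrix.one_mul]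

/-- The QR decomposition with positive diagonal exists for a matrix of full column rank. -/
theorem qFactor_spec {m d : ℕ} (h : d ≤ m) {A : Matrix (Fin m) (Fin d) ℂ}
    (hA : (Aᴴ * A).det ≠ 0) :
    OrthonormalCols (qFactor h A) ∧ IsUpperTriPos (rFactor h A) ∧
      A = qFactor h A * rFactor h A := by
  obtain ⟨S, R, hS, hR, hSR, hq⟩ := exists_qr_eq_qFactor h A
  have hr : rFactor h A = R := by
    rw [rFactor, ← hq hA, hSR, ← Matrix.mul_assoc, hS, Matrix.one_mul]
  rw [hr, ← hq hA]
  refine ⟨hS, hR.isUpperTriPos fun h0 => hA ?_, hSR⟩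
  rw [hSR, gram_eq hS, det_mul, h0, mul_zero]

theorem IsUpperTriPos.isUpperTriNonneg {d : ℕ} {Y : Matrix (Fin d) (Fin d) ℂ}
    (h : IsUpperTriPos Y) : IsUpperTriNonneg Y :=
  ⟨h.1, fun i => ⟨(h.2 i).1.le, (h.2 i).2⟩⟩

/-- Equality of the Gram matrices makes `R * R'⁻¹` unitary with adjoint `R' * R⁻¹`. Both are upper
triangular, so `R * R'⁻¹` is diagonal; its diagonal entries are positive of modulus one. -/
theorem isUpperTriPos_unique {d : ℕ} {R R' : Matrix (Fin d) (Fin d) ℂ}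
    (hR : IsUpperTriPos R) (hR' : IsUpperTriPos R') (h : Rᴴ * R = R'ᴴ * R') : R = R' := by
  have hu : IsUnit R.det := hR.det_ne_zero.isUnit
  have hu' : IsUnit R'.det := hR'.det_ne_zero.isUnit
  have : Invertible R := invertibleOfIsUnitDet R hu
  have : Invertible R' := invertibleOfIsUnitDet R' hu'
  have t1 : (R * R'⁻¹).BlockTriangular id :=
    BlockTriangular.mul (fun a b hab => hR.1 a b hab)
      (blockTriangular_inv_of_blockTriangular fun a b hab => hR'.1 a b hab)
  have t2 : (R' * R⁻¹).BlockTriangular id :=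
    BlockTriangular.mul (fun a b hab => hR'.1 a b hab)
      (blockTriangular_inv_of_blockTriangular fun a b hab => hR.1 a b hab)
  have h1 : (R * R'⁻¹)ᴴ = R' * R⁻¹ := by
    have e1 : Rᴴ = R'ᴴ * (R' * R⁻¹) := by
      rw [← Matrix.mul_assoc, ← h, Matrix.mul_assoc, mul_nonsing_inv R hu, Matrix.mul_one]
    rw [conjTranspose_mul, e1, ← Matrix.mul_assoc, ← conjTranspose_mul, mul_nonsing_inv R' hu',
      conjTranspose_one, Matrix.one_mul]
  have hdiag : ∀ i j, i ≠ j → (R * R'⁻¹) i j = 0 := by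
    intro i j hij
    rcases lt_or_gt_of_ne hij with hlt | hgt
    · have := congrFun (congrFun h1 j) i
      rw [conjTranspose_apply, t2 hlt] at this
      simpa using this
    · exact t1 hgt
  have hTR : R = (R * R'⁻¹) * R' := by
    rw [Matrix.mul_assoc, nonsing_inv_mul R' hu', Matrix.mul_one]
  have hentry : ∀ i j, R i j = (R * R'⁻¹) i i * R' i j := by
    intro i j
    conv_lhs => rw [hTR, Matrix.mul_apply]
    refine Finset.sum_eq_single i (fun k _ hk => ?_) (by simp)
    rw [hdiag i k hk.symm, zero_mul]
  have hone : ∀ i, (R * R'⁻¹) i i = 1 := by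
    intro i
    have hu1 : (R * R'⁻¹)ᴴ * (R * R'⁻¹) = 1 := by
      rw [h1, Matrix.mul_assoc, ← Matrix.mul_assoc R⁻¹, nonsing_inv_mul R hu, Matrix.one_mul,
        mul_nonsing_inv R' hu']
    have h2 := congrFun (congrFun hu1 i) i
    rw [Matrix.mul_apply, Finset.sum_eq_single i (fun k _ hk => by rw [hdiag k i hk, mul_zero])
      (by simp), conjTranspose_apply, Matrix.one_apply_eq] at h2
    have h3 := hentry i i
    have hr : R i i = ((R i i).re : ℂ) := Complex.ext rfl (by simp [(hR.2 i).2])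
    have hr' : R' i i = ((R' i i).re : ℂ) := Complex.ext rfl (by simp [(hR'.2 i).2])
    have p := (hR.2 i).1
    have p' := (hR'.2 i).1
    have ht : (R * R'⁻¹) i i = (((R i i).re / (R' i i).re : ℝ) : ℂ) := by
      have : (R' i i) ≠ 0 := fun h0 => by rw [h0] at p'; simp at p'
      rw [Complex.ofReal_div, ← hr, ← hr', h3, mul_div_assoc, div_self this, mul_one]
    rw [ht] at h2 ⊢
    have hp : 0 < (R i i).re / (R' i i).re := div_pos p p'
    generalize (R i i).re / (R' i i).re = t at h2 hp
    have h4 : t * t = 1 := by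
      have h5 : ((t * t : ℝ) : ℂ) = ((1 : ℝ) : ℂ) := by simpa using h2
      exact_mod_cast h5
    have : t = 1 := by nlinarith
    rw [this, Complex.ofReal_one]
  ext i j
  rw [hentry, hone, one_mul]

theorem gram_det_ne_zero {m d : ℕ} {S : Matrix (Fin m) (Fin d) ℂ} {R : Matrix (Fin d) (Fin d) ℂ}
    (hS : OrthonormalCols S) (hR : IsUpperTriPos R) : ((S * R)ᴴ * (S * R)).det ≠ 0 := by
  rw [gram_eq hS, det_mul, det_conjTranspose]
  exact mul_ne_zero (star_ne_zero.2 hR.det_ne_zero) hR.det_ne_zero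

/-- The QR decomposition with positive diagonal is unique. -/
theorem qr_unique {m d : ℕ} (h : d ≤ m) {S : Matrix (Fin m) (Fin d) ℂ}
    {R : Matrix (Fin d) (Fin d) ℂ} (hS : OrthonormalCols S) (hR : IsUpperTriPos R) :
    qFactor h (S * R) = S ∧ rFactor h (S * R) = R := by
  obtain ⟨h1, h2, h3⟩ := qFactor_spec h (gram_det_ne_zero hS hR)
  have hr : rFactor h (S * R) = R := isUpperTriPos_unique h2 hR (by
    rw [← gram_eq h1, ← h3, gram_eq hS])
  refine ⟨?_, hr⟩
  rw [hr] at h3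
  have h4 := congrArg (· * R⁻¹) h3
  simp only [Matrix.mul_assoc, mul_nonsing_inv R hR.det_ne_zero.isUnit, Matrix.mul_one] at h4
  exact h4.symm

/-- Moving `U` into the orthonormal factor leaves a QR decomposition with positive diagonal, and
uniqueness identifies it. This makes the triangular factor an invariant of the rotations used below.
-/
theorem qr_mul_left {m m' d : ℕ} (h : d ≤ m) (h' : d ≤ m') {A : Matrix (Fin m) (Fin d) ℂ}
    (hA : (Aᴴ * A).det ≠ 0) {U : Matrix (Fin m') (Fin m) ℂ} (hU : OrthonormalCols U) :
    qFactor h' (U * A) = U * qFactor h A ∧ rFactor h' (U * A) = rFactor h A := by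
  obtain ⟨h1, h2, h3⟩ := qFactor_spec h hA
  have h4 : U * A = U * qFactor h A * rFactor h A := by rw [Matrix.mul_assoc, ← h3]
  rw [h4]
  exact qr_unique h' ((gram_eq hU _).trans h1) h2

/-! ### Transitivity of the unitary group -/

/-- The unitary group acts transitively on matrices with orthonormal columns. -/
theorem exists_unitary_mul_eq {m : ℕ} {ι : Type*} [Fintype ι] [DecidableEq ι]
    {S S' : Matrix (Fin m) ι ℂ} (hS : Sᴴ * S = 1) (hS' : S'ᴴ * S' = 1) :
    ∃ T : unitaryGroup (Fin m) ℂ, (T : Matrix (Fin m) (Fin m) ℂ) * S = S' := by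
  classical
  have key : ∀ W : Matrix (Fin m) ι ℂ, Wᴴ * W = 1 →
      Orthonormal ℂ (fun j => (WithLp.toLp 2 (fun i => W i j) : EuclideanSpace ℂ (Fin m))) := by
    intro W hW
    rw [orthonormal_iff_ite]
    intro i j
    rw [← Matrix.one_apply, ← hW]
    simp [PiLp.inner_apply, Matrix.mul_apply, mul_comm]
  have hc : Fintype.card ι ≤ m := by
    have := (key S hS).linearIndependent.fintype_card_le_finrank
    simpa using this
  obtain ⟨e⟩ : Nonempty (ι ↪ Fin m) := Function.Embedding.nonempty_of_card_le (by simpa using hc)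
  -- Complete each system to a unitary matrix, with the given columns at the positions chosen by
  -- `e`; the required unitary is then the quotient of the two completions.
  have ext : ∀ W : Matrix (Fin m) ι ℂ, Wᴴ * W = 1 →
      ∃ T ∈ unitaryGroup (Fin m) ℂ, ∀ i j, T i (e j) = W i j := by
    intro W hW
    let v : Fin m → EuclideanSpace ℂ (Fin m) := fun k =>
      if hk : ∃ j, e j = k then WithLp.toLp 2 (fun i => W i hk.choose) else 0
    have hv : ∀ j, v (e j) = WithLp.toLp 2 (fun i => W i j) := by
      intro j
      have hk : ∃ j', e j' = e j := ⟨j, rfl⟩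
      have : hk.choose = j := e.injective hk.choose_spec
      simp only [v, dif_pos hk, this]
    have ho : Orthonormal ℂ ((Set.range e).domRestrict v) := by
      rw [orthonormal_iff_ite]
      rintro ⟨_, i, rfl⟩ ⟨_, j, rfl⟩
      have := orthonormal_iff_ite.1 (key W hW) i j
      simp only [Set.domRestrict_apply, hv, this]
      exact if_congr ⟨fun hij => Subtype.ext (congrArg e hij),
        fun hij => e.injective (congrArg Subtype.val hij)⟩ rfl rfl
    obtain ⟨b, hb⟩ := ho.exists_orthonormalBasis_extension_of_card_eq (by simp)
    refine ⟨Matrix.of fun i j => b j i, ?_, fun i j => ?_⟩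
    · rw [mem_unitaryGroup_iff']
      ext i j
      have := orthonormal_iff_ite.1 b.orthonormal i j
      rw [Matrix.one_apply, ← this]
      simp [PiLp.inner_apply, Matrix.mul_apply, mul_comm, star_eq_conjTranspose]
    · change b (e j) i = W i j
      rw [hb _ ⟨j, rfl⟩, hv]
  obtain ⟨T, hT, hTS⟩ := ext S hS
  obtain ⟨T', hT', hTS'⟩ := ext S' hS'
  let E : Matrix (Fin m) ι ℂ := (1 : Matrix (Fin m) (Fin m) ℂ).submatrix id e
  have hE : ∀ A : Matrix (Fin m) (Fin m) ℂ, A * E = A.submatrix id e := by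
    intro A
    have := Matrix.submatrix_mul A 1 id id e Function.bijective_id
    rw [Matrix.mul_one] at this
    exact this.symm
  have h1 : S = T * E := by
    ext i j; rw [hE]; exact (hTS i j).symm
  have h2 : S' = T' * E := by
    ext i j; rw [hE]; exact (hTS' i j).symm
  refine ⟨⟨T', hT'⟩ * (⟨T, hT⟩ : unitaryGroup (Fin m) ℂ)⁻¹, ?_⟩
  have h3 : star T * T = 1 := mem_unitaryGroup_iff'.1 hT
  change T' * star T * S = S'
  rw [h1, h2, Matrix.mul_assoc, ← Matrix.mul_assoc (star T), h3, Matrix.one_mul]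

theorem orthonormalCols_of_mem {m : ℕ} {U : Matrix (Fin m) (Fin m) ℂ}
    (hU : U ∈ unitaryGroup (Fin m) ℂ) : OrthonormalCols U := mem_unitaryGroup_iff'.1 hU

theorem mem_unitaryGroup_of_orthonormalCols {m : ℕ} {U : Matrix (Fin m) (Fin m) ℂ}
    (hU : OrthonormalCols U) : U ∈ unitaryGroup (Fin m) ℂ := mem_unitaryGroup_iff'.2 hU

/-! ### Chordal distance and the deterministic decomposition -/

theorem frobSq_eq_trace {m n : ℕ} (A : Matrix (Fin m) (Fin n) ℂ) :
    (frobSq A : ℂ) = (Aᴴ * A).trace := by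
  rw [frobSq, Finset.sum_comm, Matrix.trace]
  push_cast
  refine Finset.sum_congr rfl fun j _ => ?_
  rw [diag_apply, Matrix.mul_apply]
  refine Finset.sum_congr rfl fun i _ => ?_
  rw [conjTranspose_apply]
  exact (Complex.conj_mul' _).symm

/-- Expand the square: both projections have trace `d`, and the two cross terms have equal trace. -/
theorem chordalDistSq_eq_trace {M d : ℕ} {V Vh : Matrix (Fin M) (Fin d) ℂ}
    (hV : OrthonormalCols V) (hVh : OrthonormalCols Vh) :
    (chordalDistSq V Vh : ℂ) = (1 - (Vhᴴ * V)ᴴ * (Vhᴴ * V)).trace := by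
  have hV' : Vᴴ * V = 1 := hV
  have hVh' : Vhᴴ * Vh = 1 := hVh
  have e1 : (V * Vᴴ * (V * Vᴴ)).trace = (d : ℂ) := by
    rw [Matrix.mul_assoc, ← Matrix.mul_assoc Vᴴ, hV', Matrix.one_mul, Matrix.trace_mul_comm, hV']
    simp
  have e2 : (Vh * Vhᴴ * (Vh * Vhᴴ)).trace = (d : ℂ) := by
    rw [Matrix.mul_assoc, ← Matrix.mul_assoc Vhᴴ, hVh', Matrix.one_mul, Matrix.trace_mul_comm, hVh']
    simp
  have e3 : (V * Vᴴ * (Vh * Vhᴴ)).trace = ((Vhᴴ * V)ᴴ * (Vhᴴ * V)).trace := by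
    rw [conjTranspose_mul, conjTranspose_conjTranspose, Matrix.mul_assoc, Matrix.trace_mul_comm]
    simp only [Matrix.mul_assoc]
  have e4 : (Vh * Vhᴴ * (V * Vᴴ)).trace = ((Vhᴴ * V)ᴴ * (Vhᴴ * V)).trace := by
    rw [Matrix.trace_mul_comm, e3]
  rw [chordalDistSq, Complex.ofReal_mul, frobSq_eq_trace]
  simp only [conjTranspose_sub, conjTranspose_mul V, conjTranspose_mul Vh Vhᴴ,
    conjTranspose_conjTranspose]
  rw [Matrix.sub_mul, Matrix.mul_sub, Matrix.mul_sub, trace_sub, trace_sub, trace_sub, trace_sub,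
    e1, e2, e3, e4]
  simp
  ring

theorem IsLeftNullBasis.conjTranspose_mul_eq_zero {M d : ℕ} {Vh : Matrix (Fin M) (Fin d) ℂ}
    {N : Matrix (Fin M) (Fin (M - d)) ℂ} (hN : IsLeftNullBasis Vh N) : Nᴴ * Vh = 0 := by
  have := congrArg conjTranspose hN.2
  simpa using this

/-- The projections onto the column space of `Vh` and onto its complement add up to `1`. -/
theorem IsLeftNullBasis.add_eq_one {M d : ℕ} (hd : d ≤ M) {Vh : Matrix (Fin M) (Fin d) ℂ}
    {N : Matrix (Fin M) (Fin (M - d)) ℂ} (hVh : OrthonormalCols Vh) (hN : IsLeftNullBasis Vh N) :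
    Vh * Vhᴴ + N * Nᴴ = 1 := by
  have hN' : Nᴴ * N = 1 := hN.1
  have hVh' : Vhᴴ * Vh = 1 := hVh
  have h1 : (fromRows Vhᴴ Nᴴ) * (fromCols Vh N) = 1 := by
    rw [fromRows_mul_fromCols, hVh', hN', hN.conjTranspose_mul_eq_zero, hN.2, fromBlocks_one]
  have h2 := (mul_eq_one_comm_of_equiv (A := fromRows Vhᴴ Nᴴ) (B := fromCols Vh N)
    (finSumFinEquiv.trans (finCongr (by omega)))).1 h1
  rwa [fromCols_mul_fromRows] at h2

/-- This is Pythagoras: insert the resolution of the identity between `Vᴴ` and `V`. It also turns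
the second determinant condition into full column rank of `Nᴴ * V`. -/
theorem IsLeftNullBasis.gram_add_gram {M d : ℕ} (hd : d ≤ M) {V Vh : Matrix (Fin M) (Fin d) ℂ}
    {N : Matrix (Fin M) (Fin (M - d)) ℂ} (hV : OrthonormalCols V) (hVh : OrthonormalCols Vh)
    (hN : IsLeftNullBasis Vh N) :
    (Nᴴ * V)ᴴ * (Nᴴ * V) = 1 - (Vhᴴ * V)ᴴ * (Vhᴴ * V) := by
  have hV' : Vᴴ * V = 1 := hV
  rw [eq_sub_iff_add_eq]
  simp only [conjTranspose_mul, conjTranspose_conjTranspose]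
  have : Vᴴ * N * (Nᴴ * V) + Vᴴ * Vh * (Vhᴴ * V) = Vᴴ * (Vh * Vhᴴ + N * Nᴴ) * V := by
    rw [Matrix.mul_add, Matrix.add_mul, add_comm]
    simp only [Matrix.mul_assoc]
  rw [this, hN.add_eq_one hd hVh, Matrix.mul_one, hV']

/-- Orthogonality of `Vh` and `N` lets each block be read off separately. Together with the converse
`isCDDecomp_of_mul_eq`, this reduces every question about the decomposition to two QR
decompositions. -/
theorem IsCDDecomp.conjTranspose_mul_eq {M d : ℕ} {V Vh : Matrix (Fin M) (Fin d) ℂ}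
    {N : Matrix (Fin M) (Fin (M - d)) ℂ} {X Y : Matrix (Fin d) (Fin d) ℂ}
    {S : Matrix (Fin (M - d)) (Fin d) ℂ} {Z : Matrix (Fin d) (Fin d) ℂ}
    (hVh : OrthonormalCols Vh) (hN : IsLeftNullBasis Vh N) (h : IsCDDecomp V Vh N X Y S Z) :
    Vhᴴ * V = X * Y ∧ Nᴴ * V = S * Z := by
  have hN' : Nᴴ * N = 1 := hN.1
  have hVh' : Vhᴴ * Vh = 1 := hVh
  rw [h.eq, Matrix.mul_add, Matrix.mul_add]
  simp only [← Matrix.mul_assoc]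
  rw [hN', hVh', hN.2, hN.conjTranspose_mul_eq_zero]
  simp

theorem isCDDecomp_of_mul_eq {M d : ℕ} (hd : d ≤ M) {V Vh : Matrix (Fin M) (Fin d) ℂ}
    {N : Matrix (Fin M) (Fin (M - d)) ℂ} {X Y : Matrix (Fin d) (Fin d) ℂ}
    {S : Matrix (Fin (M - d)) (Fin d) ℂ} {Z : Matrix (Fin d) (Fin d) ℂ}
    (hVh : OrthonormalCols Vh) (hN : IsLeftNullBasis Vh N) (hX : OrthonormalCols X)
    (hS : OrthonormalCols S) (hY : IsUpperTriNonneg Y) (hZ : IsUpperTriNonneg Z)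
    (hA : Vhᴴ * V = X * Y) (hB : Nᴴ * V = S * Z) : IsCDDecomp V Vh N X Y S Z := by
  refine ⟨?_, hX, hS, hY, hZ⟩
  rw [Matrix.mul_assoc, ← hA, Matrix.mul_assoc, ← hB, ← Matrix.mul_assoc, ← Matrix.mul_assoc,
    ← Matrix.add_mul, hN.add_eq_one hd hVh, Matrix.one_mul]

theorem exists_isCDDecomp {M d : ℕ} (hMd : 2 * d ≤ M) {V Vh : Matrix (Fin M) (Fin d) ℂ}
    {N : Matrix (Fin M) (Fin (M - d)) ℂ} (hV : OrthonormalCols V) (hVh : OrthonormalCols Vh)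
    (hN : IsLeftNullBasis Vh N) :
    ∃ (X Y : Matrix (Fin d) (Fin d) ℂ) (S : Matrix (Fin (M - d)) (Fin d) ℂ)
      (Z : Matrix (Fin d) (Fin d) ℂ), IsCDDecomp V Vh N X Y S Z ∧
        ((Vhᴴ * V).det ≠ 0 → IsUpperTriPos Y) ∧
        ((1 - (Vhᴴ * V)ᴴ * (Vhᴴ * V)).det ≠ 0 → IsUpperTriPos Z) := by
  obtain ⟨X, Y, hX, hY, hA, -⟩ := exists_qr_eq_qFactor le_rfl (Vhᴴ * V)
  obtain ⟨S, Z, hS, hZ, hB, -⟩ := exists_qr_eq_qFactor (by omega : d ≤ M - d) (Nᴴ * V)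
  refine ⟨X, Y, S, Z, isCDDecomp_of_mul_eq (by omega) hVh hN hX hS hY hZ hA hB,
    fun h => hY.isUpperTriPos fun h0 => h ?_, fun h => hZ.isUpperTriPos fun h0 => h ?_⟩
  · rw [hA, det_mul, h0, mul_zero]
  · rw [← hN.gram_add_gram (by omega) hV hVh, hB, gram_eq hS, det_mul, h0, mul_zero]

theorem IsCDDecomp.trace_and_gram {M d : ℕ} (hd : d ≤ M) {V Vh : Matrix (Fin M) (Fin d) ℂ}
    {N : Matrix (Fin M) (Fin (M - d)) ℂ} {X Y : Matrix (Fin d) (Fin d) ℂ}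
    {S : Matrix (Fin (M - d)) (Fin d) ℂ} {Z : Matrix (Fin d) (Fin d) ℂ}
    (hV : OrthonormalCols V) (hVh : OrthonormalCols Vh) (hN : IsLeftNullBasis Vh N)
    (h : IsCDDecomp V Vh N X Y S Z) :
    (Zᴴ * Z).trace = (chordalDistSq V Vh : ℂ) ∧ Yᴴ * Y = 1 - Zᴴ * Z := by
  obtain ⟨hA, hB⟩ := h.conjTranspose_mul_eq hVh hN
  have hg := hN.gram_add_gram hd hV hVh
  rw [chordalDistSq_eq_trace hV hVh, ← hg, hB, gram_eq h.orthS]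
  rw [hB, gram_eq h.orthS, hA, gram_eq h.orthX] at hg
  exact ⟨rfl, by rw [hg, sub_sub_cancel]⟩

/-! ### Measurability of the QR factors -/

section Measurability

instance matrixBorelSpace {m n : ℕ} : BorelSpace (Matrix (Fin m) (Fin n) ℂ) :=
  inferInstanceAs (BorelSpace (Fin m → Fin n → ℂ))

variable {α : Type*} [MeasurableSpace α]

theorem measurable_matrix_iff {m n : ℕ} {f : α → Matrix (Fin m) (Fin n) ℂ} :
    Measurable f ↔ ∀ i j, Measurable fun a => f a i j := by
  refine ⟨fun h i j => ?_, fun h => ?_⟩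
  · exact (measurable_pi_apply j).comp ((measurable_pi_apply i).comp h)
  · exact measurable_pi_lambda _ fun i => measurable_pi_lambda _ fun j => h i j

theorem Measurable.matrix_mul {m n k : ℕ} {f : α → Matrix (Fin m) (Fin n) ℂ}
    {g : α → Matrix (Fin n) (Fin k) ℂ} (hf : Measurable f) (hg : Measurable g) :
    Measurable fun a => f a * g a := by
  rw [measurable_matrix_iff] at *
  intro i j
  simp only [Matrix.mul_apply]
  exact Finset.measurable_sum _ fun k _ => (hf i k).mul (hg k j)

theorem Measurable.matrix_conjTranspose {m n : ℕ} {f : α → Matrix (Fin m) (Fin n) ℂ}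
    (hf : Measurable f) : Measurable fun a => (f a)ᴴ := by
  rw [measurable_matrix_iff] at *
  intro i j
  exact continuous_star.measurable.comp (hf j i)

theorem Measurable.matrix_det {n : ℕ} {f : α → Matrix (Fin n) (Fin n) ℂ}
    (hf : Measurable f) : Measurable fun a => (f a).det := by
  rw [measurable_matrix_iff] at hf
  simp only [Matrix.det_apply]
  refine Finset.measurable_sum _ fun σ _ => ?_
  exact (Finset.measurable_prod _ fun i _ => hf (σ i) i).const_smul (Equiv.Perm.sign σ)

theorem measurable_matrix_add {m n : ℕ} {f g : α → Matrix (Fin m) (Fin n) ℂ}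
    (hf : Measurable f) (hg : Measurable g) : Measurable fun a => f a + g a := by
  rw [measurable_matrix_iff] at *
  exact fun i j => (hf i j).add (hg i j)

theorem measurable_matrix_sub {m n : ℕ} {f g : α → Matrix (Fin m) (Fin n) ℂ}
    (hf : Measurable f) (hg : Measurable g) : Measurable fun a => f a - g a := by
  rw [measurable_matrix_iff] at *
  exact fun i j => (hf i j).sub (hg i j)

open InnerProductSpace in
theorem measurable_gramSchmidt {m : ℕ} {f : α → Fin m → EuclideanSpace ℂ (Fin m)}
    (hf : ∀ j, Measurable fun a => f a j) (j : Fin m) :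
    Measurable fun a => gramSchmidt ℂ (f a) j := by
  induction j using WellFoundedLT.induction with
  | ind j ih =>
    simp only [gramSchmidt_def ℂ _ j, Submodule.starProjection_singleton]
    refine (hf j).sub (Finset.measurable_sum _ fun i hi => ?_)
    have hi' := ih i (Finset.mem_Iio.1 hi)
    refine Measurable.smul (Measurable.div (Measurable.inner (𝕜 := ℂ) hi' (hf j)) ?_) hi'
    exact Complex.measurable_ofReal.comp (hi'.norm.pow_const 2)

open InnerProductSpace in
theorem measurable_qFactor {m d : ℕ} (h : d ≤ m) :
    Measurable (qFactor h : Matrix (Fin m) (Fin d) ℂ → _) := by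
  have hp : ∀ j, Measurable fun A : Matrix (Fin m) (Fin d) ℂ => paddedCols A j := by
    intro j
    unfold paddedCols
    by_cases hj : (j : ℕ) < d
    · simp only [dif_pos hj]
      refine (MeasurableEquiv.toLp 2 (Fin m → ℂ)).measurable.comp (measurable_pi_lambda _ fun i => ?_)
      exact measurable_matrix_iff.1 measurable_id i ⟨j, hj⟩
    · simp only [dif_neg hj]
      exact measurable_const
  rw [measurable_matrix_iff]
  intro i j
  have hg := measurable_gramSchmidt hp (Fin.castLE h j)
  have : Measurable fun A : Matrix (Fin m) (Fin d) ℂ =>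
      gramSchmidtNormed ℂ (paddedCols A) (Fin.castLE h j) := by
    unfold gramSchmidtNormed
    exact Measurable.smul (Complex.measurable_ofReal.comp hg.norm).inv hg
  exact (measurable_pi_apply i).comp
    ((MeasurableEquiv.toLp 2 (Fin m → ℂ)).symm.measurable.comp this)

theorem measurable_rFactor {m d : ℕ} (h : d ≤ m) :
    Measurable (rFactor h : Matrix (Fin m) (Fin d) ℂ → _) :=
  (measurable_qFactor h).matrix_conjTranspose.matrix_mul measurable_id

end Measurability

/-! ### Independence by averaging over a group -/

section Averaging

/-- There is a right-invariant probability measure on the unitary group. -/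
theorem exists_unitaryGroup_rightInvariant (m : ℕ) :
    ∃ ν : Measure (unitaryGroup (Fin m) ℂ), IsProbabilityMeasure ν ∧ ν.IsMulRightInvariant := by
  have : SecondCountableTopology (Matrix (Fin m) (Fin m) ℂ) :=
    inferInstanceAs (SecondCountableTopology (Fin m → Fin m → ℂ))
  have : BorelSpace (unitaryGroup (Fin m) ℂ) := Subtype.borelSpace _
  have hcl : IsClosed {U : Matrix (Fin m) (Fin m) ℂ | U ∈ unitaryGroup (Fin m) ℂ} := by
    simp only [mem_unitaryGroup_iff, star_eq_conjTranspose]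
    exact isClosed_eq (by fun_prop) continuous_const
  have hcomp : IsCompact {U : Matrix (Fin m) (Fin m) ℂ | U ∈ unitaryGroup (Fin m) ℂ} := by
    refine IsCompact.of_isClosed_subset (s := {U : Fin m → Fin m → ℂ | ∀ i, U i ∈
      {v : Fin m → ℂ | ∀ j, v j ∈ Metric.closedBall (0 : ℂ) 1}}) ?_ hcl ?_
    · exact isCompact_pi_infinite fun i => isCompact_pi_infinite fun j => isCompact_closedBall 0 1
    · intro U hU i j
      rw [mem_closedBall_zero_iff]
      exact entry_norm_bound_of_unitary hU i j
  have : CompactSpace (unitaryGroup (Fin m) ℂ) := isCompact_iff_compactSpace.1 hcomp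
  let K : TopologicalSpace.PositiveCompacts (unitaryGroup (Fin m) ℂ) := ⊤
  have hp : IsProbabilityMeasure (Measure.haarMeasure K) := ⟨Measure.haarMeasure_self⟩
  -- Haar measure is left-invariant; its image under inversion is right-invariant.
  refine ⟨(Measure.haarMeasure K).inv, ?_, inferInstance⟩
  exact Measure.isProbabilityMeasure_map measurable_inv.aemeasurable

/-- If the law of `P` is invariant under a measurable family of transformations indexed by a group,
`z` is invariant under these and the group acts transitively on the values of `s`, then
`s ∘ P` and `z ∘ P` are independent. -/
theorem indepFun_of_invariant {Ω E F F' G : Type*} [MeasurableSpace Ω] [MeasurableSpace E]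
    [MeasurableSpace F] [MeasurableSpace F'] [MeasurableSpace G] [Group G] [MeasurableMul G]
    (ν : Measure G) [IsProbabilityMeasure ν] [ν.IsMulRightInvariant]
    (μ : Measure Ω) [IsProbabilityMeasure μ] {P : Ω → E} (hP : Measurable P)
    {a : G → E → E} (ha : Measurable (Function.uncurry a)) {s : E → F} (hs : Measurable s)
    {z : E → F'} (hz : Measurable z) {good : E → Prop} (hgood : ∀ᵐ ω ∂μ, good (P ω))
    (hinv : ∀ g, (μ.map P).map (a g) = μ.map P)
    (hza : ∀ e, good e → ∀ g, z (a g e) = z e)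
    (hsa : ∀ e e', good e → good e' → ∃ T, ∀ g, s (a (g * T) e) = s (a g e')) :
    IndepFun (fun ω => s (P ω)) (fun ω => z (P ω)) μ := by
  rw [indepFun_iff_measure_inter_preimage_eq_mul]
  intro C D hC hD
  obtain ⟨ω₀, h₀⟩ := hgood.exists
  have hag : ∀ g, Measurable (a g) := fun g => ha.comp measurable_prodMk_left
  have hae : ∀ e, Measurable fun g => a g e := fun e => ha.comp measurable_prodMk_right
  set c := ν {g | s (a g (P ω₀)) ∈ C} with hc
  -- Transitivity replaces `e` by `P ω₀` at the cost of a right translation in the group, which `ν`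
  -- does not see.
  have hconst : ∀ e, good e → ν {g | s (a g e) ∈ C} = c := by
    intro e he
    obtain ⟨T, hT⟩ := hsa e (P ω₀) he h₀
    have h1 := (measurePreserving_mul_right ν T).measure_preimage
      ((hs.comp (hae e)) hC).nullMeasurableSet
    rw [hc]
    simp only [← hT]
    exact h1.symm
  have key : ∀ D, MeasurableSet D → μ {ω | s (P ω) ∈ C ∧ z (P ω) ∈ D} =
      c * μ {ω | z (P ω) ∈ D} := by
    intro D hD
    let B : Set E := s ⁻¹' C ∩ z ⁻¹' D
    have hB : MeasurableSet B := (hs hC).inter (hz hD)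
    have hBa : MeasurableSet {q : G × Ω | a q.1 (P q.2) ∈ B} :=
      (ha.comp (measurable_fst.prodMk (hP.comp measurable_snd))) hB
    have h1 : ∀ g, μ {ω | a g (P ω) ∈ B} = μ {ω | s (P ω) ∈ C ∧ z (P ω) ∈ D} := by
      intro g
      have h2 := congrArg (fun ρ => ρ B) (hinv g)
      simp only [Measure.map_apply (hag g) hB, Measure.map_apply hP (hag g hB),
        Measure.map_apply hP hB] at h2
      exact h2
    -- Compute this product measure in both orders. With `g` fixed, invariance of the law makes
    -- every slice equally likely; with `ω` fixed, `z` does not move and the slice has measure `c`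
    -- or `0`.
    have h3 : (ν.prod μ) {q : G × Ω | a q.1 (P q.2) ∈ B} =
        μ {ω | s (P ω) ∈ C ∧ z (P ω) ∈ D} := by
      rw [Measure.prod_apply hBa]
      exact (lintegral_congr h1).trans (by simp)
    rw [← h3, Measure.prod_apply_symm hBa]
    have hzD : MeasurableSet {ω | z (P ω) ∈ D} := (hz.comp hP) hD
    rw [← lintegral_indicator_const hzD c]
    refine lintegral_congr_ae ?_
    filter_upwards [hgood] with ω hω
    by_cases hω' : z (P ω) ∈ D
    · rw [Set.indicator_of_mem (by exact hω'), ← hconst _ hω]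
      refine congrArg ν (Set.ext fun g => ?_)
      simp [B, hza _ hω g, hω']
    · rw [Set.indicator_of_notMem (by exact hω')]
      refine (congrArg ν (Set.ext fun g => ?_)).trans measure_empty
      simp [B, hza _ hω g, hω']
  -- Taking `D` to be everything identifies `c` as the probability of the event for `s`.
  have hcC : μ {ω | s (P ω) ∈ C} = c := by
    have := key Set.univ MeasurableSet.univ
    simpa using this
  exact (key D hD).trans (by rw [← hcC]; rfl)

end Averaging

/-! ### Full rank almost surely under isotropy -/

section GeneralPosition

/-- Multilinearity in the rows. The sum runs over all index maps, not only increasing ones, so that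
they can be matched with base-`M` digit expansions. -/
theorem det_mul_eq_sum_submatrix {R : Type*} [CommRing R] {M d : ℕ}
    (C : Matrix (Fin d) (Fin M) R) (v : Matrix (Fin M) (Fin d) R) :
    (C * v).det = ∑ f : Fin d → Fin M, (∏ j, C j (f j)) * (v.submatrix f id).det := by
  have h1 : C * v = Matrix.of fun j => ∑ k, C j k • v k := by
    ext i j
    simp [Matrix.mul_apply]
  have h2 := (detRowAlternating (n := Fin d) (R := R)).toMultilinearMap.map_sum
    fun j k => C j k • v k
  rw [h1]
  refine h2.trans (Finset.sum_congr rfl fun f _ => ?_)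
  rw [MultilinearMap.map_smul_univ, smul_eq_mul]
  rfl

open Polynomial in
/-- The matrices with entries `t ^ (k * M ^ j)` for natural numbers `t` are in general position:
each matrix of full column rank is degenerate with respect to only finitely many of them. -/
theorem finite_det_powMatrix_eq_zero {M d : ℕ} {v : Matrix (Fin M) (Fin d) ℂ}
    (hv : OrthonormalCols v) :
    {t : ℕ | ((Matrix.of fun (j : Fin d) (k : Fin M) => (t : ℂ) ^ ((k : ℕ) * M ^ (j : ℕ))) *
      v).det = 0}.Finite := by
  -- The exponent is the number with base-`M` digits `f j`, so different `f` give different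
  -- monomials and each minor is a coefficient of `p`.
  let p : ℂ[X] := ∑ f : Fin d → Fin M, monomial (finFunctionFinEquiv f : ℕ) (v.submatrix f id).det
  have heval : ∀ t : ℂ, p.eval t =
      ((Matrix.of fun (j : Fin d) (k : Fin M) => t ^ ((k : ℕ) * M ^ (j : ℕ))) * v).det := by
    intro t
    rw [det_mul_eq_sum_submatrix, eval_finsetSum]
    refine Finset.sum_congr rfl fun f _ => ?_
    rw [eval_monomial, finFunctionFinEquiv_apply, Finset.prod_pow_eq_pow_sum .. |>.symm, mul_comm]
    rfl
  have hcoeff : ∀ f : Fin d → Fin M,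
      p.coeff (finFunctionFinEquiv f : ℕ) = (v.submatrix f id).det := by
    intro f
    rw [finsetSum_coeff, Finset.sum_eq_single f]
    · rw [coeff_monomial, if_pos rfl]
    · intro g _ hg
      rw [coeff_monomial, if_neg]
      exact fun h => hg (finFunctionFinEquiv.injective (Fin.ext h))
    · simp
  have hp : p ≠ 0 := by
    intro hp
    -- If all minors vanish, the same expansion with `vᴴ` on the left contradicts orthonormality.
    have h1 : (vᴴ * v).det = 0 := by
      rw [det_mul_eq_sum_submatrix]
      refine Finset.sum_eq_zero fun f _ => ?_
      rw [← hcoeff, hp, coeff_zero, mul_zero]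
    rw [show vᴴ * v = 1 from hv, det_one] at h1
    exact one_ne_zero h1
  refine Set.Finite.of_finite_image (f := fun t : ℕ => (t : ℂ))
    ((p.rootSet_finite ℂ).subset ?_) Nat.cast_injective.injOn
  rintro _ ⟨t, ht, rfl⟩
  rw [mem_rootSet_of_ne hp, coe_aeval_eq_eval, heval]
  exact ht

/-- The limit superior of the sets is null, yet every tail union has measure at least `c`;
continuity from above forces `c = 0`. -/
theorem measure_eq_zero_of_finite_mem {α : Type*} [MeasurableSpace α] {μ : Measure α}
    [IsFiniteMeasure μ] {s : ℕ → Set α} (hs : ∀ n, MeasurableSet (s n))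
    {c : ENNReal} (hc : ∀ n, μ (s n) = c) (hfin : ∀ᵐ x ∂μ, {n | x ∈ s n}.Finite) : c = 0 := by
  let F : ℕ → Set α := fun n => ⋃ k ≥ n, s k
  have hF : Antitone F := by
    intro m n hmn
    exact Set.biUnion_subset_biUnion_left fun k (hk : n ≤ k) => hmn.trans hk
  have hlim := tendsto_measure_iInter_atTop (μ := μ) (s := F)
    (fun n => (MeasurableSet.iUnion fun k => MeasurableSet.iUnion fun _ => hs k).nullMeasurableSet)
    hF ⟨0, measure_ne_top _ _⟩
  have h0 : μ (⋂ n, F n) = 0 := by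
    refine measure_mono_null (t := {x | ¬ {n | x ∈ s n}.Finite}) ?_ hfin
    intro x hx hf
    obtain ⟨b, hb⟩ := hf.bddAbove
    have := Set.mem_iInter.1 hx (b + 1)
    simp only [F, Set.mem_iUnion] at this
    obtain ⟨k, hk, hxk⟩ := this
    have := hb hxk
    omega
  rw [h0] at hlim
  refine le_antisymm (ge_of_tendsto' hlim fun n => ?_) zero_le
  rw [← hc n]
  exact measure_mono (Set.subset_biUnion_of_mem (u := fun k => s k) (le_refl n : n ≥ n))

theorem map_mul_left_eq {Ω : Type*} [MeasurableSpace Ω] {μ : Measure Ω} {M d : ℕ}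
    {V : Ω → Matrix (Fin M) (Fin d) ℂ} (hV : Measurable V) (h : IsIsotropic μ V)
    {Q : Matrix (Fin M) (Fin M) ℂ} (hQ : Q ∈ unitaryGroup (Fin M) ℂ) :
    (μ.map V).map (fun v => Q * v) = μ.map V := by
  have hm : Measurable fun v : Matrix (Fin M) (Fin d) ℂ => Q * v :=
    measurable_const.matrix_mul measurable_id
  exact (Measure.map_map hm hV).trans (h Q hQ)

/-- Rotate `K` onto the orthonormal QR factor of each power matrix. By invariance all the rotated
degeneracy events have the same measure, while each orthonormal `v` lies in only finitely many. -/
theorem ae_det_ne_zero_of_invariant {M d : ℕ} (hd : d ≤ M)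
    (ρ : Measure (Matrix (Fin M) (Fin d) ℂ)) [IsProbabilityMeasure ρ]
    (horth : ∀ᵐ v ∂ρ, OrthonormalCols v)
    (hinv : ∀ Q ∈ unitaryGroup (Fin M) ℂ, ρ.map (fun v => Q * v) = ρ)
    {K : Matrix (Fin M) (Fin d) ℂ} (hK : OrthonormalCols K) :
    ∀ᵐ v ∂ρ, (Kᴴ * v).det ≠ 0 := by
  let G : ℕ → Matrix (Fin M) (Fin d) ℂ :=
    fun t => Matrix.of fun k j => (t : ℂ) ^ ((k : ℕ) * M ^ (j : ℕ))
  have hT : ∀ t, ∃ T : unitaryGroup (Fin M) ℂ, ∀ v : Matrix (Fin M) (Fin d) ℂ,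
      (Kᴴ * ((T : Matrix (Fin M) (Fin M) ℂ) * v)).det = 0 → ((G t)ᴴ * v).det = 0 := by
    intro t
    obtain ⟨S, R, hS, -, hG, -⟩ := exists_qr_eq_qFactor hd (G t)
    obtain ⟨T, hTS⟩ := exists_unitary_mul_eq hS hK
    refine ⟨T, fun v hv => ?_⟩
    have hTT : (T : Matrix (Fin M) (Fin M) ℂ)ᴴ * T = 1 := mem_unitaryGroup_iff'.1 T.2
    have h1 : Sᴴ = Kᴴ * (T : Matrix (Fin M) (Fin M) ℂ) := by
      rw [← hTS, conjTranspose_mul, Matrix.mul_assoc, hTT, Matrix.mul_one]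
    rw [hG, conjTranspose_mul, h1, Matrix.mul_assoc, Matrix.mul_assoc, det_mul, hv, mul_zero]
  choose T hT using hT
  have hmeas : ∀ t, Measurable fun v : Matrix (Fin M) (Fin d) ℂ =>
      (T t : Matrix (Fin M) (Fin M) ℂ) * v :=
    fun t => measurable_const.matrix_mul measurable_id
  have hE : MeasurableSet {v : Matrix (Fin M) (Fin d) ℂ | (Kᴴ * v).det = 0} :=
    (measurable_const.matrix_mul measurable_id).matrix_det (measurableSet_singleton 0)
  have h0 := measure_eq_zero_of_finite_mem (μ := ρ)
    (s := fun t => {v | (Kᴴ * ((T t : Matrix (Fin M) (Fin M) ℂ) * v)).det = 0})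
    (c := ρ {v | (Kᴴ * v).det = 0}) (fun t => hmeas t hE) (fun t => by
      have := congrArg (fun σ => σ {v | (Kᴴ * v).det = 0}) (hinv (T t) (T t).2)
      simp only [Measure.map_apply (hmeas t) hE] at this
      exact this) (by
      filter_upwards [horth] with v hv
      refine (finite_det_powMatrix_eq_zero hv).subset fun t ht => ?_
      have h1 := hT t v ht
      have h2 : (G t)ᴴ = Matrix.of fun (j : Fin d) (k : Fin M) =>
          (t : ℂ) ^ ((k : ℕ) * M ^ (j : ℕ)) := by
        ext i j
        simp [G]
      rwa [h2] at h1)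
  rw [ae_iff]
  simpa using h0

-- A kernel vector of the Gram matrix is already killed by `A`, hence by every selection of its
-- rows.
open ComplexOrder in
theorem gram_det_ne_zero_of_submatrix {m d : ℕ} {A : Matrix (Fin m) (Fin d) ℂ} (e : Fin d → Fin m)
    (h : (A.submatrix e id).det ≠ 0) : (Aᴴ * A).det ≠ 0 := by
  intro h0
  obtain ⟨x, hx, hAx⟩ := exists_mulVec_eq_zero_iff.2 h0
  rw [conjTranspose_mul_self_mulVec_eq_zero] at hAx
  refine h (exists_mulVec_eq_zero_iff.1 ⟨x, hx, funext fun i => ?_⟩)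
  exact congrFun hAx (e i)

/-- The first `d` columns of `K` reduce this to the square case. -/
theorem ae_gram_det_ne_zero_of_invariant {M m d : ℕ} (hd : d ≤ M) (hm : d ≤ m)
    (ρ : Measure (Matrix (Fin M) (Fin d) ℂ)) [IsProbabilityMeasure ρ]
    (horth : ∀ᵐ v ∂ρ, OrthonormalCols v)
    (hinv : ∀ Q ∈ unitaryGroup (Fin M) ℂ, ρ.map (fun v => Q * v) = ρ)
    {K : Matrix (Fin M) (Fin m) ℂ} (hK : OrthonormalCols K) :
    ∀ᵐ v ∂ρ, ((Kᴴ * v)ᴴ * (Kᴴ * v)).det ≠ 0 := by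
  have hK' : OrthonormalCols (K.submatrix id (Fin.castLE hm)) := by
    ext i j
    have := congrFun (congrFun (show Kᴴ * K = 1 from hK) (Fin.castLE hm i)) (Fin.castLE hm j)
    simp only [Matrix.one_apply, (Fin.castLE_injective hm).eq_iff] at this
    rw [Matrix.one_apply, ← this]
    rfl
  filter_upwards [ae_det_ne_zero_of_invariant hd ρ horth hinv hK'] with v hv
  exact gram_det_ne_zero_of_submatrix (Fin.castLE hm) hv

end GeneralPosition

/-! ### Independence of the QR factors in the three settings -/

section Independence

variable {Ω : Type*} [MeasurableSpace Ω] {μ : Measure Ω} [IsProbabilityMeasure μ] {M d : ℕ}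
  {V Vh : Ω → Matrix (Fin M) (Fin d) ℂ}

/-- The matrix acts as `U` in the coordinates given by `K` and as the identity on the orthogonal
complement. -/
theorem orthonormalCols_rotation {M m : ℕ} {K : Matrix (Fin M) (Fin m) ℂ} (hK : OrthonormalCols K)
    {U : Matrix (Fin m) (Fin m) ℂ} (hU : OrthonormalCols U) :
    OrthonormalCols (K * U * Kᴴ + (1 - K * Kᴴ)) := by
  have hK' : Kᴴ * K = 1 := hK
  have hU' : Uᴴ * U = 1 := hU
  have h1 : Kᴴ * (1 - K * Kᴴ) = 0 := by
    rw [Matrix.mul_sub, ← Matrix.mul_assoc, hK', Matrix.one_mul, Matrix.mul_one, sub_self]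
  have h2 : (1 - K * Kᴴ) * K = 0 := by
    rw [Matrix.sub_mul, Matrix.mul_assoc, hK', Matrix.one_mul, Matrix.mul_one, sub_self]
  have h3 : (1 - K * Kᴴ)ᴴ = 1 - K * Kᴴ := by
    simp [conjTranspose_mul]
  have h4 : (1 - K * Kᴴ) * (1 - K * Kᴴ) = 1 - K * Kᴴ := by
    rw [Matrix.mul_sub, ← Matrix.mul_assoc, h2, Matrix.zero_mul, sub_zero, Matrix.mul_one]
  have h5 : (K * U * Kᴴ)ᴴ = K * Uᴴ * Kᴴ := by
    simp [conjTranspose_mul, Matrix.mul_assoc]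
  have e1 : K * Uᴴ * Kᴴ * (K * U * Kᴴ) = K * Kᴴ := by
    calc K * Uᴴ * Kᴴ * (K * U * Kᴴ) = K * Uᴴ * (Kᴴ * K) * U * Kᴴ := by
          simp only [Matrix.mul_assoc]
      _ = K * (Uᴴ * U) * Kᴴ := by rw [hK', Matrix.mul_one]; simp only [Matrix.mul_assoc]
      _ = K * Kᴴ := by rw [hU', Matrix.mul_one]
  have e2 : K * Uᴴ * Kᴴ * (1 - K * Kᴴ) = 0 := by rw [Matrix.mul_assoc, h1, Matrix.mul_zero]
  have e3 : (1 - K * Kᴴ) * (K * U * Kᴴ) = 0 := by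
    rw [Matrix.mul_assoc K, ← Matrix.mul_assoc, h2, Matrix.zero_mul]
  rw [OrthonormalCols, conjTranspose_add, h3, h5, Matrix.add_mul, Matrix.mul_add, Matrix.mul_add,
    e1, e2, e3, h4]
  abel

theorem conjTranspose_mul_rotation {M m k : ℕ} {K : Matrix (Fin M) (Fin m) ℂ}
    (hK : OrthonormalCols K) (U : Matrix (Fin m) (Fin m) ℂ) (v : Matrix (Fin M) (Fin k) ℂ) :
    Kᴴ * ((K * U * Kᴴ + (1 - K * Kᴴ)) * v) = U * (Kᴴ * v) := by
  have hK' : Kᴴ * K = 1 := hK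
  rw [← Matrix.mul_assoc, Matrix.mul_add, Matrix.mul_sub, Matrix.mul_assoc K, ← Matrix.mul_assoc,
    ← Matrix.mul_assoc Kᴴ K Kᴴ, hK']
  simp [Matrix.mul_assoc]

theorem map_prodMk_of_indepFun (hV : Measurable V) (hVh : Measurable Vh) (h : IndepFun V Vh μ) :
    μ.map (fun ω => (Vh ω, V ω)) = (μ.map Vh).prod (μ.map V) :=
  (indepFun_iff_map_prod_eq_prod_map_map hVh.aemeasurable hV.aemeasurable).1 h.symm

/-- If `V` is isotropic and independent of `Vh`, then the coordinates of `V` in an orthonormal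
system of at least `d` vectors that depends on `Vh` are almost surely of full rank. -/
theorem ae_gram_det_ne_zero_of_isIsotropic (hd : d ≤ M) {m : ℕ} (hm : d ≤ m)
    {k : Matrix (Fin M) (Fin d) ℂ → Matrix (Fin M) (Fin m) ℂ} (hk : Measurable k)
    (hko : ∀ W, OrthonormalCols W → OrthonormalCols (k W))
    (hV : Measurable V) (hVh : Measurable Vh) (hVo : ∀ ω, OrthonormalCols (V ω))
    (hVho : ∀ ω, OrthonormalCols (Vh ω)) (hiso : IsIsotropic μ V) (hind : IndepFun V Vh μ) :
    ∀ᵐ ω ∂μ, (((k (Vh ω))ᴴ * V ω)ᴴ * ((k (Vh ω))ᴴ * V ω)).det ≠ 0 := by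
  have hp : MeasurableSet {p : Matrix (Fin M) (Fin d) ℂ × Matrix (Fin M) (Fin d) ℂ |
      (((k p.1)ᴴ * p.2)ᴴ * ((k p.1)ᴴ * p.2)).det ≠ 0} := by
    have h1 : Measurable fun p : Matrix (Fin M) (Fin d) ℂ × Matrix (Fin M) (Fin d) ℂ =>
        (k p.1)ᴴ * p.2 := (hk.comp measurable_fst).matrix_conjTranspose.matrix_mul measurable_snd
    exact (h1.matrix_conjTranspose.matrix_mul h1).matrix_det (measurableSet_singleton 0).compl
  have ho : MeasurableSet {W : Matrix (Fin M) (Fin d) ℂ | OrthonormalCols W} :=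
    (measurable_id.matrix_conjTranspose.matrix_mul measurable_id) (measurableSet_singleton 1)
  have : IsProbabilityMeasure (μ.map V) := Measure.isProbabilityMeasure_map hV.aemeasurable
  have : IsProbabilityMeasure (μ.map Vh) := Measure.isProbabilityMeasure_map hVh.aemeasurable
  have h1 : ∀ᵐ p ∂(μ.map fun ω => (Vh ω, V ω)),
      (((k p.1)ᴴ * p.2)ᴴ * ((k p.1)ᴴ * p.2)).det ≠ 0 := by
    -- By independence, it suffices to freeze `Vh` at an orthonormal value and use the isotropy of
    -- `V` alone.
    rw [map_prodMk_of_indepFun hV hVh hind, Measure.ae_prod_iff_ae_ae hp]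
    have h2 : ∀ᵐ W ∂(μ.map Vh), OrthonormalCols W :=
      (ae_map_iff hVh.aemeasurable ho).2 (ae_of_all _ hVho)
    filter_upwards [h2] with W hW
    exact ae_gram_det_ne_zero_of_invariant hd hm _
      ((ae_map_iff hV.aemeasurable ho).2 (ae_of_all _ hVo))
      (fun Q hQ => map_mul_left_eq hV hiso hQ) (hko W hW)
  exact (ae_map_iff (hVh.prodMk hV).aemeasurable hp).1 h1

/-- Rotate `V` inside the span of `k (Vh)`: the coordinates `k(Vh)ᴴ V` are multiplied by `U`. Taking
`k` to be the identity or `nul` handles both pairs of factors. -/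
theorem indepFun_qr_of_isIsotropic {m : ℕ} (hm : d ≤ m)
    {k : Matrix (Fin M) (Fin d) ℂ → Matrix (Fin M) (Fin m) ℂ} (hk : Measurable k)
    (hko : ∀ W, OrthonormalCols W → OrthonormalCols (k W))
    (hV : Measurable V) (hVh : Measurable Vh)
    (hVho : ∀ ω, OrthonormalCols (Vh ω)) (hiso : IsIsotropic μ V) (hind : IndepFun V Vh μ)
    (hdet : ∀ᵐ ω ∂μ, (((k (Vh ω))ᴴ * V ω)ᴴ * ((k (Vh ω))ᴴ * V ω)).det ≠ 0) :
    IndepFun (fun ω => qFactor hm ((k (Vh ω))ᴴ * V ω))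
      (fun ω => rFactor hm ((k (Vh ω))ᴴ * V ω)) μ := by
  obtain ⟨ν, hν, hνr⟩ := exists_unitaryGroup_rightInvariant m
  have : IsProbabilityMeasure (μ.map V) := Measure.isProbabilityMeasure_map hV.aemeasurable
  have : IsProbabilityMeasure (μ.map Vh) := Measure.isProbabilityMeasure_map hVh.aemeasurable
  have ho : MeasurableSet {W : Matrix (Fin M) (Fin d) ℂ | OrthonormalCols W} :=
    (measurable_id.matrix_conjTranspose.matrix_mul measurable_id) (measurableSet_singleton 1)
  have hc : Measurable fun p : Matrix (Fin M) (Fin d) ℂ × Matrix (Fin M) (Fin d) ℂ =>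
      (k p.1)ᴴ * p.2 := (hk.comp measurable_fst).matrix_conjTranspose.matrix_mul measurable_snd
  let a : unitaryGroup (Fin m) ℂ → Matrix (Fin M) (Fin d) ℂ × Matrix (Fin M) (Fin d) ℂ →
      Matrix (Fin M) (Fin d) ℂ × Matrix (Fin M) (Fin d) ℂ := fun U p =>
    (p.1, (k p.1 * (U : Matrix (Fin m) (Fin m) ℂ) * (k p.1)ᴴ + (1 - k p.1 * (k p.1)ᴴ)) * p.2)
  have ha : Measurable (Function.uncurry a) := by
    have h1 : Measurable fun q : unitaryGroup (Fin m) ℂ ×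
        (Matrix (Fin M) (Fin d) ℂ × Matrix (Fin M) (Fin d) ℂ) => k q.2.1 :=
      hk.comp (measurable_fst.comp measurable_snd)
    have h2 : Measurable fun q : unitaryGroup (Fin m) ℂ ×
        (Matrix (Fin M) (Fin d) ℂ × Matrix (Fin M) (Fin d) ℂ) => (q.1 : Matrix (Fin m) (Fin m) ℂ) :=
      measurable_subtype_coe.comp measurable_fst
    refine (measurable_fst.comp measurable_snd).prodMk
      (Measurable.matrix_mul ?_ (measurable_snd.comp measurable_snd))
    exact measurable_matrix_add ((h1.matrix_mul h2).matrix_mul h1.matrix_conjTranspose)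
      (measurable_matrix_sub measurable_const (h1.matrix_mul h1.matrix_conjTranspose))
  have hca : ∀ U p, OrthonormalCols p.1 → (k (a U p).1)ᴴ * (a U p).2 =
      (U : Matrix (Fin m) (Fin m) ℂ) * ((k p.1)ᴴ * p.2) := fun U p hp =>
    conjTranspose_mul_rotation (hko _ hp) _ _
  refine indepFun_of_invariant ν μ (P := fun ω => (Vh ω, V ω)) (hVh.prodMk hV) ha
    (s := fun p => qFactor hm ((k p.1)ᴴ * p.2)) ((measurable_qFactor hm).comp hc)
    (z := fun p => rFactor hm ((k p.1)ᴴ * p.2)) ((measurable_rFactor hm).comp hc)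
    (good := fun p => OrthonormalCols p.1 ∧ (((k p.1)ᴴ * p.2)ᴴ * ((k p.1)ᴴ * p.2)).det ≠ 0)
    ?_ ?_ ?_ ?_
  · filter_upwards [hdet] with ω hω
    exact ⟨hVho ω, hω⟩
  · intro U
    rw [map_prodMk_of_indepFun hV hVh hind]
    -- The rotation depends on `Vh`, but for each frozen value it is a fixed unitary preserving the
    -- law of `V`; the product law is therefore preserved.
    refine (MeasurePreserving.skew_product (MeasurePreserving.id (μ.map Vh)) (g := fun w v =>
      (k w * (U : Matrix (Fin m) (Fin m) ℂ) * (k w)ᴴ + (1 - k w * (k w)ᴴ)) * v) ?_ ?_).map_eq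
    · exact measurable_snd.comp (ha.comp (measurable_prodMk_left (x := U)))
    · have h2 : ∀ᵐ W ∂(μ.map Vh), OrthonormalCols W :=
        (ae_map_iff hVh.aemeasurable ho).2 (ae_of_all _ hVho)
      filter_upwards [h2] with W hW
      exact map_mul_left_eq hV hiso (mem_unitaryGroup_of_orthonormalCols
        (orthonormalCols_rotation (hko _ hW) (orthonormalCols_of_mem U.2)))
  · rintro p ⟨hp, hp'⟩ U
    simp only [hca U p hp]
    exact (qr_mul_left hm hm hp' (orthonormalCols_of_mem U.2)).2
  · rintro p p' ⟨hp, hpd⟩ ⟨hp', hpd'⟩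
    obtain ⟨T, hT⟩ := exists_unitary_mul_eq (qFactor_spec hm hpd).1 (qFactor_spec hm hpd').1
    refine ⟨T, fun U => ?_⟩
    simp only [hca _ _ hp, hca _ _ hp']
    rw [(qr_mul_left hm hm hpd (orthonormalCols_of_mem (U * T).2)).1,
      (qr_mul_left hm hm hpd' (orthonormalCols_of_mem U.2)).1, ← hT, Submonoid.coe_mul,
      Matrix.mul_assoc]

/-- Changing the basis `Vh` to `Vh Uᴴ` multiplies `Vhᴴ V` by `U`; only the invariance with `Q = 1`
enters. -/
theorem indepFun_qr_of_isJointlyIsotropic (hV : Measurable V) (hVh : Measurable Vh)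
    (hiso : IsJointlyIsotropic μ V Vh)
    (hdet : ∀ᵐ ω ∂μ, (((Vh ω)ᴴ * V ω)ᴴ * ((Vh ω)ᴴ * V ω)).det ≠ 0) :
    IndepFun (fun ω => qFactor le_rfl ((Vh ω)ᴴ * V ω))
      (fun ω => rFactor le_rfl ((Vh ω)ᴴ * V ω)) μ := by
  obtain ⟨ν, hν, hνr⟩ := exists_unitaryGroup_rightInvariant d
  have hc : Measurable fun p : Matrix (Fin M) (Fin d) ℂ × Matrix (Fin M) (Fin d) ℂ =>
      p.2ᴴ * p.1 := measurable_snd.matrix_conjTranspose.matrix_mul measurable_fst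
  let a : unitaryGroup (Fin d) ℂ → Matrix (Fin M) (Fin d) ℂ × Matrix (Fin M) (Fin d) ℂ →
      Matrix (Fin M) (Fin d) ℂ × Matrix (Fin M) (Fin d) ℂ := fun U p =>
    (p.1, p.2 * (U : Matrix (Fin d) (Fin d) ℂ)ᴴ)
  have ha : Measurable (Function.uncurry a) :=
    (measurable_fst.comp measurable_snd).prodMk ((measurable_snd.comp measurable_snd).matrix_mul
      (measurable_subtype_coe.comp measurable_fst).matrix_conjTranspose)
  have hca : ∀ U p, (a U p).2ᴴ * (a U p).1 = (U : Matrix (Fin d) (Fin d) ℂ) * (p.2ᴴ * p.1) :=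
    fun U p => by simp [a, Matrix.mul_assoc]
  refine indepFun_of_invariant ν μ (P := fun ω => (V ω, Vh ω)) (hV.prodMk hVh) ha
    (s := fun p => qFactor le_rfl (p.2ᴴ * p.1)) ((measurable_qFactor le_rfl).comp hc)
    (z := fun p => rFactor le_rfl (p.2ᴴ * p.1)) ((measurable_rFactor le_rfl).comp hc)
    (good := fun p => ((p.2ᴴ * p.1)ᴴ * (p.2ᴴ * p.1)).det ≠ 0) hdet ?_ ?_ ?_
  · intro U
    have h1 := hiso 1 (one_mem _) (U : Matrix (Fin d) (Fin d) ℂ)ᴴ (Unitary.star_mem U.2)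
    simp only [Matrix.one_mul] at h1
    exact (Measure.map_map (ha.comp (measurable_prodMk_left (x := U))) (hV.prodMk hVh)).trans h1
  · intro p hp U
    simp only [hca U p]
    exact (qr_mul_left _ _ hp (orthonormalCols_of_mem U.2)).2
  · intro p p' hp hp'
    obtain ⟨T, hT⟩ := exists_unitary_mul_eq (qFactor_spec le_rfl hp).1 (qFactor_spec le_rfl hp').1
    refine ⟨T, fun U => ?_⟩
    simp only [hca]
    rw [(qr_mul_left le_rfl _ hp (orthonormalCols_of_mem (U * T).2)).1,
      (qr_mul_left le_rfl _ hp' (orthonormalCols_of_mem U.2)).1, ← hT, Submonoid.coe_mul,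
      Matrix.mul_assoc]

/-- Rotate `V` and `Vh` together by `Q`. The map `nul` need not be equivariant, but `nul (Q Vh)` and
`Q nul(Vh)` span the same space, so the coordinates change by the unitary `nul(Q Vh)ᴴ Q nul(Vh)`.
Only the invariance with `U = 1` enters. -/
theorem indepFun_qr_null_of_isJointlyIsotropic (hd : d ≤ M) (hm : d ≤ M - d)
    {nul : Matrix (Fin M) (Fin d) ℂ → Matrix (Fin M) (Fin (M - d)) ℂ} (hnul : Measurable nul)
    (hN : ∀ W, OrthonormalCols W → IsLeftNullBasis W (nul W))
    (hV : Measurable V) (hVh : Measurable Vh) (hVho : ∀ ω, OrthonormalCols (Vh ω))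
    (hiso : IsJointlyIsotropic μ V Vh)
    (hdet : ∀ᵐ ω ∂μ, (((nul (Vh ω))ᴴ * V ω)ᴴ * ((nul (Vh ω))ᴴ * V ω)).det ≠ 0) :
    IndepFun (fun ω => qFactor hm ((nul (Vh ω))ᴴ * V ω))
      (fun ω => rFactor hm ((nul (Vh ω))ᴴ * V ω)) μ := by
  obtain ⟨ν, hν, hνr⟩ := exists_unitaryGroup_rightInvariant M
  have hc : Measurable fun p : Matrix (Fin M) (Fin d) ℂ × Matrix (Fin M) (Fin d) ℂ =>
      (nul p.2)ᴴ * p.1 :=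
    (hnul.comp measurable_snd).matrix_conjTranspose.matrix_mul measurable_fst
  let a : unitaryGroup (Fin M) ℂ → Matrix (Fin M) (Fin d) ℂ × Matrix (Fin M) (Fin d) ℂ →
      Matrix (Fin M) (Fin d) ℂ × Matrix (Fin M) (Fin d) ℂ := fun Q p =>
    ((Q : Matrix (Fin M) (Fin M) ℂ) * p.1, (Q : Matrix (Fin M) (Fin M) ℂ) * p.2)
  have hQm : Measurable fun q : unitaryGroup (Fin M) ℂ ×
      (Matrix (Fin M) (Fin d) ℂ × Matrix (Fin M) (Fin d) ℂ) => (q.1 : Matrix (Fin M) (Fin M) ℂ) :=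
    measurable_subtype_coe.comp measurable_fst
  have ha : Measurable (Function.uncurry a) :=
    (hQm.matrix_mul (measurable_fst.comp measurable_snd)).prodMk
      (hQm.matrix_mul (measurable_snd.comp measurable_snd))
  have horth : ∀ (Q : unitaryGroup (Fin M) ℂ) (W : Matrix (Fin M) (Fin d) ℂ), OrthonormalCols W →
      OrthonormalCols ((Q : Matrix (Fin M) (Fin M) ℂ) * W) := fun Q W hW =>
    (gram_eq (orthonormalCols_of_mem Q.2) W).trans hW
  have hca : ∀ (Q : unitaryGroup (Fin M) ℂ) p, OrthonormalCols p.2 →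
      OrthonormalCols ((nul (a Q p).2)ᴴ * ((Q : Matrix (Fin M) (Fin M) ℂ) * nul p.2)) ∧
      (nul (a Q p).2)ᴴ * (a Q p).1 =
        (nul (a Q p).2)ᴴ * ((Q : Matrix (Fin M) (Fin M) ℂ) * nul p.2) * ((nul p.2)ᴴ * p.1) := by
    intro Q p hp
    have hQ : (Q : Matrix (Fin M) (Fin M) ℂ)ᴴ * Q = 1 := mem_unitaryGroup_iff'.1 Q.2
    have hN1 := hN _ hp
    have hN2 := hN _ (horth Q _ hp)
    have hz : (nul ((Q : Matrix (Fin M) (Fin M) ℂ) * p.2))ᴴ *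
        ((Q : Matrix (Fin M) (Fin M) ℂ) * p.2) = 0 := hN2.conjTranspose_mul_eq_zero
    have hz' : (((Q : Matrix (Fin M) (Fin M) ℂ) * p.2)ᴴ *
        ((Q : Matrix (Fin M) (Fin M) ℂ) * nul p.2)) = 0 := by
      rw [conjTranspose_mul, Matrix.mul_assoc, ← Matrix.mul_assoc (Q : Matrix (Fin M) (Fin M) ℂ)ᴴ, hQ,
        Matrix.one_mul, hN1.2]
    constructor
    · have h1 : OrthonormalCols ((Q : Matrix (Fin M) (Fin M) ℂ) * nul p.2) :=
        (gram_eq (orthonormalCols_of_mem Q.2) _).trans hN1.1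
      change ((nul ((Q : Matrix (Fin M) (Fin M) ℂ) * p.2))ᴴ * _)ᴴ *
        ((nul ((Q : Matrix (Fin M) (Fin M) ℂ) * p.2))ᴴ * _) = 1
      generalize (Q : Matrix (Fin M) (Fin M) ℂ) * nul p.2 = L at h1 hz' ⊢
      have h3 := hN2.add_eq_one hd (horth Q _ hp)
      generalize (Q : Matrix (Fin M) (Fin M) ℂ) * p.2 = W at hz' h3 ⊢
      have h4 : nul W * (nul W)ᴴ = 1 - W * Wᴴ := by rw [← h3]; simp
      rw [conjTranspose_mul, conjTranspose_conjTranspose, Matrix.mul_assoc,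
        ← Matrix.mul_assoc (nul W), h4, Matrix.sub_mul, Matrix.mul_assoc W, hz', Matrix.mul_zero,
        sub_zero, Matrix.one_mul]
      exact h1
    · have h3 := hN1.add_eq_one hd hp
      have h4 : nul p.2 * (nul p.2)ᴴ = 1 - p.2 * p.2ᴴ := by rw [← h3]; simp
      change (nul ((Q : Matrix (Fin M) (Fin M) ℂ) * p.2))ᴴ * ((Q : Matrix (Fin M) (Fin M) ℂ) * p.1) =
        (nul ((Q : Matrix (Fin M) (Fin M) ℂ) * p.2))ᴴ * _ * _
      rw [Matrix.mul_assoc, Matrix.mul_assoc (Q : Matrix (Fin M) (Fin M) ℂ), ← Matrix.mul_assoc (nul p.2), h4,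
        Matrix.sub_mul, Matrix.mul_sub, Matrix.mul_sub, Matrix.one_mul, Matrix.mul_assoc p.2,
        ← Matrix.mul_assoc (Q : Matrix (Fin M) (Fin M) ℂ) p.2,
        ← Matrix.mul_assoc _ ((Q : Matrix (Fin M) (Fin M) ℂ) * p.2), hz, Matrix.zero_mul, sub_zero]
  refine indepFun_of_invariant ν μ (P := fun ω => (V ω, Vh ω)) (hV.prodMk hVh) ha
    (s := fun p => qFactor hm ((nul p.2)ᴴ * p.1)) ((measurable_qFactor hm).comp hc)
    (z := fun p => rFactor hm ((nul p.2)ᴴ * p.1)) ((measurable_rFactor hm).comp hc)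
    (good := fun p => OrthonormalCols p.2 ∧
      (((nul p.2)ᴴ * p.1)ᴴ * ((nul p.2)ᴴ * p.1)).det ≠ 0) ?_ ?_ ?_ ?_
  · filter_upwards [hdet] with ω hω
    exact ⟨hVho ω, hω⟩
  · intro Q
    have h1 := hiso Q Q.2 1 (one_mem _)
    simp only [Matrix.mul_one] at h1
    exact (Measure.map_map (ha.comp (measurable_prodMk_left (x := Q))) (hV.prodMk hVh)).trans h1
  · rintro p ⟨hp, hpd⟩ Q
    have h1 := hca Q p hp
    simp only [h1.2]
    exact (qr_mul_left hm hm hpd h1.1).2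
  · rintro p p' ⟨hp, hpd⟩ ⟨hp', hpd'⟩
    -- Transitivity needs one unitary matching both `p.2` and the vectors `nul p.2 * qFactor ..`.
    -- Matching `p.2` makes the two values of `nul` coincide after rotation; the rest then matches
    -- the orthonormal factors.
    have hblock : ∀ p : Matrix (Fin M) (Fin d) ℂ × Matrix (Fin M) (Fin d) ℂ, OrthonormalCols p.2 →
        (((nul p.2)ᴴ * p.1)ᴴ * ((nul p.2)ᴴ * p.1)).det ≠ 0 →
        (fromCols p.2 (nul p.2 * qFactor hm ((nul p.2)ᴴ * p.1)))ᴴ *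
          fromCols p.2 (nul p.2 * qFactor hm ((nul p.2)ᴴ * p.1)) = 1 := by
      intro p hp hpd
      have h1 := (qFactor_spec hm hpd).1
      generalize qFactor hm ((nul p.2)ᴴ * p.1) = S at h1
      have hp' : p.2ᴴ * p.2 = 1 := hp
      have h2 : (nul p.2 * S)ᴴ * (nul p.2 * S) = 1 := (gram_eq (hN _ hp).1 S).trans h1
      rw [conjTranspose_fromCols_eq_fromRows_conjTranspose, fromRows_mul_fromCols, hp', h2,
        ← Matrix.mul_assoc, (hN _ hp).2, Matrix.zero_mul, conjTranspose_mul, Matrix.mul_assoc,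
        (hN _ hp).conjTranspose_mul_eq_zero, Matrix.mul_zero, fromBlocks_one]
    obtain ⟨T, hT⟩ := exists_unitary_mul_eq (hblock p hp hpd) (hblock p' hp' hpd')
    rw [mul_fromCols] at hT
    obtain ⟨hT1, hT2⟩ := fromCols_inj hT
    refine ⟨T, fun Q => ?_⟩
    have h1 := hca (Q * T) p hp
    have h2 := hca Q p' hp'
    simp only [h1.2, h2.2]
    rw [(qr_mul_left hm hm hpd h1.1).1, (qr_mul_left hm hm hpd' h2.1).1]
    have h3 : (a (Q * T) p).2 = (a Q p').2 := by
      simp only [a, Submonoid.coe_mul, Matrix.mul_assoc, hT1]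
    rw [h3, Submonoid.coe_mul]
    simp only [Matrix.mul_assoc]
    rw [hT2]

end Independence

/-! ### Assembly -/

theorem lemma1 (M d : ℕ) (hMd : 2 * d ≤ M) :
    -- Deterministic part: existence of the factors and their properties.
    (∀ (V Vh : Matrix (Fin M) (Fin d) ℂ) (N : Matrix (Fin M) (Fin (M - d)) ℂ),
      OrthonormalCols V → OrthonormalCols Vh → IsLeftNullBasis Vh N →
        (∃ (X Y : Matrix (Fin d) (Fin d) ℂ) (S : Matrix (Fin (M - d)) (Fin d) ℂ)
            (Z : Matrix (Fin d) (Fin d) ℂ),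
          IsCDDecomp V Vh N X Y S Z ∧
          ((Vhᴴ * V).det ≠ 0 → IsUpperTriPos Y) ∧
          ((1 - (Vhᴴ * V)ᴴ * (Vhᴴ * V)).det ≠ 0 → IsUpperTriPos Z)) ∧
        (∀ (X Y : Matrix (Fin d) (Fin d) ℂ) (S : Matrix (Fin (M - d)) (Fin d) ℂ)
            (Z : Matrix (Fin d) (Fin d) ℂ),
          IsCDDecomp V Vh N X Y S Z →
            (Zᴴ * Z).trace = (chordalDistSq V Vh : ℂ) ∧ Yᴴ * Y = 1 - Zᴴ * Z)) ∧
    -- Probabilistic part: independence of the factors.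
    (∀ {Ω : Type*} [MeasurableSpace Ω] (μ : Measure Ω) [IsProbabilityMeasure μ]
      (V Vh : Ω → Matrix (Fin M) (Fin d) ℂ)
      (nul : Matrix (Fin M) (Fin d) ℂ → Matrix (Fin M) (Fin (M - d)) ℂ),
      Measurable V → Measurable Vh → Measurable nul →
      (∀ ω, OrthonormalCols (V ω)) → (∀ ω, OrthonormalCols (Vh ω)) →
      (∀ W, OrthonormalCols W → IsLeftNullBasis W (nul W)) →
      ((IsIsotropic μ V ∧ IndepFun V Vh μ) ∨
        (IsJointlyIsotropic μ V Vh ∧ ∀ᵐ ω ∂μ, InGeneralPosition (V ω) (Vh ω))) →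
        (∃ (X Y : Ω → Matrix (Fin d) (Fin d) ℂ) (S : Ω → Matrix (Fin (M - d)) (Fin d) ℂ)
            (Z : Ω → Matrix (Fin d) (Fin d) ℂ),
          Measurable X ∧ Measurable Y ∧ Measurable S ∧ Measurable Z ∧
          ∀ᵐ ω ∂μ, IsCDDecomp (V ω) (Vh ω) (nul (Vh ω)) (X ω) (Y ω) (S ω) (Z ω) ∧
            IsUpperTriPos (Y ω) ∧ IsUpperTriPos (Z ω)) ∧
        (∀ (X Y : Ω → Matrix (Fin d) (Fin d) ℂ) (S : Ω → Matrix (Fin (M - d)) (Fin d) ℂ)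
            (Z : Ω → Matrix (Fin d) (Fin d) ℂ),
          Measurable X → Measurable Y → Measurable S → Measurable Z →
          (∀ᵐ ω ∂μ, IsCDDecomp (V ω) (Vh ω) (nul (Vh ω)) (X ω) (Y ω) (S ω) (Z ω) ∧
            IsUpperTriPos (Y ω) ∧ IsUpperTriPos (Z ω)) →
          IndepFun X Y μ ∧ IndepFun S Z μ)) := by
  refine ⟨fun V Vh N hV hVh hN => ⟨exists_isCDDecomp hMd hV hVh hN, fun X Y S Z h =>
    h.trace_and_gram (by omega) hV hVh hN⟩, ?_⟩
  intro Ω _ μ _ V Vh nul hV hVh hnul hVo hVho hN hlaw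
  have hd : d ≤ M := by omega
  have hm : d ≤ M - d := by omega
  -- Full rank of both coordinate matrices is automatic in the isotropic case and equivalent to
  -- general position in the other.
  have hdet : ∀ᵐ ω ∂μ, (((Vh ω)ᴴ * V ω)ᴴ * ((Vh ω)ᴴ * V ω)).det ≠ 0 ∧
      (((nul (Vh ω))ᴴ * V ω)ᴴ * ((nul (Vh ω))ᴴ * V ω)).det ≠ 0 := by
    rcases hlaw with ⟨hiso, hind⟩ | ⟨-, hgen⟩
    · exact (ae_gram_det_ne_zero_of_isIsotropic (k := fun W => W) hd le_rfl measurable_id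
        (fun _ h => h) hV hVh hVo
        hVho hiso hind).and (ae_gram_det_ne_zero_of_isIsotropic (k := nul) hd hm hnul (fun W h => (hN W h).1)
        hV hVh hVo hVho hiso hind)
    · filter_upwards [hgen] with ω hω
      rw [(hN _ (hVho ω)).gram_add_gram hd (hVo ω) (hVho ω), det_mul, det_conjTranspose]
      exact ⟨mul_ne_zero (star_ne_zero.2 hω.1) hω.1, hω.2⟩
  have hA : Measurable fun ω => (Vh ω)ᴴ * V ω := hVh.matrix_conjTranspose.matrix_mul hV
  have hB : Measurable fun ω => (nul (Vh ω))ᴴ * V ω :=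
    (hnul.comp hVh).matrix_conjTranspose.matrix_mul hV
  constructor
  · refine ⟨_, _, _, _, (measurable_qFactor le_rfl).comp hA, (measurable_rFactor le_rfl).comp hA,
      (measurable_qFactor hm).comp hB, (measurable_rFactor hm).comp hB, ?_⟩
    filter_upwards [hdet] with ω hω
    obtain ⟨hX, hY, hXY⟩ := qFactor_spec le_rfl hω.1
    obtain ⟨hS, hZ, hSZ⟩ := qFactor_spec hm hω.2
    exact ⟨isCDDecomp_of_mul_eq hd (hVho ω) (hN _ (hVho ω)) hX hS hY.isUpperTriNonneg
      hZ.isUpperTriNonneg hXY hSZ, hY, hZ⟩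
  · intro X Y S Z _ _ _ _ hdec
    -- Uniqueness identifies arbitrary factors almost surely with the Gram-Schmidt ones, so
    -- independence need only be shown for the latter.
    have huniq : ∀ᵐ ω ∂μ, (qFactor le_rfl ((Vh ω)ᴴ * V ω) = X ω ∧
        rFactor le_rfl ((Vh ω)ᴴ * V ω) = Y ω) ∧ (qFactor hm ((nul (Vh ω))ᴴ * V ω) = S ω ∧
        rFactor hm ((nul (Vh ω))ᴴ * V ω) = Z ω) := by
      filter_upwards [hdec] with ω ⟨hω, hY, hZ⟩
      obtain ⟨h1, h2⟩ := hω.conjTranspose_mul_eq (hVho ω) (hN _ (hVho ω))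
      rw [h1, h2]
      exact ⟨qr_unique _ hω.orthX hY, qr_unique _ hω.orthS hZ⟩
    have hdet1 := hdet.mono fun ω h => h.1
    have hdet2 := hdet.mono fun ω h => h.2
    have hind : IndepFun (fun ω => qFactor le_rfl ((Vh ω)ᴴ * V ω))
          (fun ω => rFactor le_rfl ((Vh ω)ᴴ * V ω)) μ ∧
        IndepFun (fun ω => qFactor hm ((nul (Vh ω))ᴴ * V ω))
          (fun ω => rFactor hm ((nul (Vh ω))ᴴ * V ω)) μ := by
      rcases hlaw with ⟨hiso, hind⟩ | ⟨hiso, -⟩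
      · exact ⟨indepFun_qr_of_isIsotropic (k := fun W => W) le_rfl measurable_id (fun _ h => h) hV
          hVh hVho hiso hind
          hdet1, indepFun_qr_of_isIsotropic (k := nul) hm hnul (fun W h => (hN W h).1) hV hVh hVho hiso hind
          hdet2⟩
      · exact ⟨indepFun_qr_of_isJointlyIsotropic hV hVh hiso hdet1,
          indepFun_qr_null_of_isJointlyIsotropic hd hm hnul hN hV hVh hVho hiso hdet2⟩
    exact ⟨hind.1.congr (huniq.mono fun _ h => h.1.1) (huniq.mono fun _ h => h.1.2),
      hind.2.congr (huniq.mono fun _ h => h.2.1) (huniq.mono fun _ h => h.2.2)⟩
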